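/- Let $(R,\mathfrak m)$ be a one-dimensional Noetherian local domain with infinite residue field and fraction field $K$. Assume that the integral closure $\overline R$ of $R$ in $K$ is a finite $R$-module and a discrete valuation ring (so $R$ is analytically irreducible), and that $R$ is residually rational, i.e. the map from the residue field of $R$ to that of $\overline R$ is an isomorphism. For $R$-submodules $J,L$ of $K$ put $J:L=\{y\in K\mid yL\subseteq J\}$ and $J^{*}=R:J$; $J$ is reflexive if $J=J^{**}$. Let $\omega$ be a canonical ideal of $R$, i.e. a nonzero fractional ideal with $\omega:(\omega:J)=J$ for every nonzero fractional ideal $J$, normalized so that $R\subseteq\omega\subseteq\overline R$. Assume that $R$ is almost Gorenstein, i.e. $\mathfrak m=\mathfrak m\omega$. Let $I$ be a non-principal $\mathfrak m$-primary ideal of $R$, and let $\Lambda=\bigcup_{n\ge 0}(I^n:I^n)$ be the blowing-up of $R$ along $I$. A minimal reduction of $I$ is an element $x\in I$ such that $I^{n+1}=xI^n$ for all large $n$. Such elements exist. For any minimal reduction $x$ of $I$ let $\nu$ be the reduction exponent, i.e. the least integer $\nu\ge 0$ such that $I^{n+1}=xI^n$ for all $n\ge\nu$. For an ideal $J$ of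 $R$ put $\widetilde J=J\omega\cap R$. Then: (1) The following conditions are all equivalent: - (A$_1$) $\omega\subseteq\Lambda$; (A$_2$) $\omega\Lambda=\Lambda$; (A$_3$) $\omega:\Lambda=R:\Lambda$; (A$_4$) $I^n=\widetilde{I^n}$ for all $n\ge\nu$; (A$_5$) $\omega I^n=I^n$ for all $n\ge\nu$; (A$_6$) $\omega I^n=I^n$ for some $n>0$; - (B$_1$) $\Lambda=\Lambda^{**}$; (B$_2$) $\omega:\Lambda=\omega(R:\Lambda)$; - (C$_1$) $\Lambda\supseteq R:\mathfrak m$; (C$_2$) $I^\nu$ is reflexive; (C$_3$) $I^n$ is reflexive for all $n\ge\nu$; (C$_4$) $I^n$ is reflexive for some $n\ge\nu$. (2) If $I$ is reflexive, then the conditions (A), (B), (C) hold; in particular $\Lambda$ is reflexive. -/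

import Mathlib

open IsLocalRing nonZeroDivisors

namespace CurveSing

/-!
Fractional ideals of the domain `R` are `R`-submodules of its fraction field `K`. For these, `1` is
the copy of `R` in `K`, `*` is the product, and Mathlib's `I / J` is the colon module
`I : J = {x ∈ K | x J ⊆ I}`.
-/

/-- The standing assumptions on the base ring: a one-dimensional Noetherian local domain with
infinite residue field, analytically irreducible (the integral closure in the fraction field is a
finite module and a discrete valuation ring) and residually rational (the map from `R` to the
residue field of the integral closure is onto, that is, `R` and its integral closure have
the same residue field). -/
class IsCurveBranch (R K : Type*) [CommRing R] [IsDomain R] [IsLocalRing R] [Field K] [Algebra R K]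
    [IsFractionRing R K] : Prop where
  noetherian : IsNoetherianRing R
  dim_one : ringKrullDim R = 1
  infinite_residueField : Infinite (ResidueField R)
  finite_integralClosure : Module.Finite R (integralClosure R K)
  dvr_integralClosure : IsDiscreteValuationRing (integralClosure R K)
  residually_rational :
    Function.Surjective ((residue (integralClosure R K)).comp (algebraMap R (integralClosure R K)))

section

variable {R K : Type*} [CommRing R] [IsDomain R] [Field K] [Algebra R K] [IsFractionRing R K]

/-- `ω` is a canonical ideal (Herzog–Kunz): a nonzero fractional ideal with `ω : (ω : J) = J` for
every nonzero fractional ideal `J`. -/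
structure IsCanonicalIdeal (ω : Submodule R K) : Prop where
  ne_bot : ω ≠ ⊥
  isFractional : IsFractional R⁰ ω
  dual_dual : ∀ J : Submodule R K, J ≠ ⊥ → IsFractional R⁰ J → ω / (ω / J) = J

/-- A canonical ideal normalized so that `R ⊆ ω ⊆ R̄`. -/
structure IsNormalizedCanonicalIdeal (ω : Submodule R K) : Prop extends IsCanonicalIdeal ω where
  one_le : 1 ≤ ω
  le_integralClosure : ω ≤ Subalgebra.toSubmodule (integralClosure R K)

variable (K) in
/-- An ideal of `R`, as a submodule of `K`. -/
abbrev toK (I : Ideal R) : Submodule R K := IsLocalization.coeSubmodule K I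

/-- `R` is almost Gorenstein: `m = m ω`, where `ω` is the normalized canonical ideal. -/
def IsAlmostGorenstein [IsLocalRing R] (ω : Submodule R K) : Prop :=
  toK K (maximalIdeal R) = toK K (maximalIdeal R) * ω

/-- The dual `J* = R : J`. -/
def dual (J : Submodule R K) : Submodule R K := 1 / J

/-- `J = J**`. -/
def IsReflexive (J : Submodule R K) : Prop := J = dual (dual J)

/-- The canonical closure `J ω ∩ R`. -/
def canonicalClosure (ω J : Submodule R K) : Submodule R K := J * ω ⊓ 1

theorem pow_div_pow_mono (J : Submodule R K) : Monotone fun n : ℕ => J ^ n / J ^ n := by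
  refine monotone_nat_of_le_succ fun n => ?_
  rw [Submodule.le_div_iff_mul_le, pow_succ, ← mul_assoc]
  have h : J ^ n / J ^ n * J ^ n ≤ J ^ n := Submodule.le_div_iff_mul_le.1 le_rfl
  gcongr

variable (K) in
/-- The blowing-up `Λ(I) = ⋃ₙ (Iⁿ : Iⁿ)` of `R` along `I`. -/
def blowup (I : Ideal R) : Submodule R K where
  carrier := ⋃ n : ℕ, ((toK K I ^ n / toK K I ^ n : Submodule R K) : Set K)
  zero_mem' := Set.mem_iUnion.2 ⟨0, Submodule.zero_mem _⟩
  add_mem' := by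
    intro a b ha hb
    obtain ⟨i, hi⟩ := Set.mem_iUnion.1 ha
    obtain ⟨j, hj⟩ := Set.mem_iUnion.1 hb
    exact Set.mem_iUnion.2 ⟨max i j, Submodule.add_mem _
      (pow_div_pow_mono (toK K I) (le_max_left i j) hi)
      (pow_div_pow_mono (toK K I) (le_max_right i j) hj)⟩
  smul_mem' := by
    intro c a ha
    obtain ⟨i, hi⟩ := Set.mem_iUnion.1 ha
    exact Set.mem_iUnion.2 ⟨i, Submodule.smul_mem _ c hi⟩

end

section

variable {R : Type*} [CommRing R]

/-- `x ∈ I` is a minimal reduction of `I`: `Iⁿ⁺¹ = x Iⁿ` for all large `n`. -/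
def IsMinimalReduction (I : Ideal R) (x : R) : Prop :=
  x ∈ I ∧ ∃ N : ℕ, ∀ n ≥ N, I ^ (n + 1) = Ideal.span {x} * I ^ n

/-- The reduction exponent: the least `ν` with `Iⁿ⁺¹ = x Iⁿ` for all `n ≥ ν`, where `x` is
a minimal reduction of `I`. -/
noncomputable def reductionExponent (I : Ideal R) (x : R) : ℕ :=
  sInf {m : ℕ | ∀ n ≥ m, I ^ (n + 1) = Ideal.span {x} * I ^ n}

end

end CurveSing

/-! Put `M = x⁻¹I`, which contains `R`. Its powers increase and are constant from `ν` on, with value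
`Λ`. So `Λ` is a fractional overring, `Iⁿ = xⁿΛ` for `n ≥ ν`, and statements about these powers
reduce to statements about `Λ` (`IsMinimalReduction.pow_eq_mul_blowup`). Since `ω : ω = R`, one has
`ω : ωJ = R : J` (`IsCanonicalIdeal.colon_mul`); with `ω`-duality this links absorption of `ω`,
equality of the two duals, and reflexivity of `Λ`. To close the circle: if `Λ` is reflexive, then `R
: Λ` is proper, hence inside `m`, so `R : m ⊆ Λ`; and `mω = m` gives `ω ⊆ R : m`. If `I` is
reflexive, then `I*I ⊆ m`, so `ωI·I* ⊆ mω = m ⊆ R` and `ωI ⊆ I** = I`, which is (A₆) with `n = 1`.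
-/

namespace CurveSing

/-! ### Colon modules and ideals inside `K`. -/

section Colon

variable {R K : Type*} [CommRing R] [Field K] [Algebra R K]

theorem colon_colon (A B C : Submodule R K) : A / B / C = A / (B * C) :=
  eq_of_forall_le_iff fun X => by
    simp only [Submodule.le_div_iff_mul_le, mul_assoc, mul_comm B C]

theorem colon_mul_le (A B : Submodule R K) : A / B * B ≤ A :=
  Submodule.le_div_iff_mul_le.1 le_rfl

theorem colon_antitone (A : Submodule R K) {B C : Submodule R K} (h : B ≤ C) : A / C ≤ A / B :=
  Submodule.le_div_iff_mul_le.2 ((mul_le_mul_right h _).trans (colon_mul_le A C))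

theorem colon_mono {A B : Submodule R K} (h : A ≤ B) (C : Submodule R K) : A / C ≤ B / C :=
  Submodule.le_div_iff_mul_le.2 ((colon_mul_le A C).trans h)

theorem le_dual_dual (J : Submodule R K) : J ≤ dual (dual J) :=
  Submodule.le_div_iff_mul_le.2 ((mul_comm _ _).trans_le (colon_mul_le 1 J))

theorem colon_one (A : Submodule R K) : A / 1 = A :=
  eq_of_forall_le_iff fun X => by rw [Submodule.le_div_iff_mul_le, mul_one]

theorem span_inv_mul_span {u : K} (hu : u ≠ 0) :
    Submodule.span R {u⁻¹} * Submodule.span R {u} = 1 := by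
  rw [Submodule.span_mul_span, Set.singleton_mul_singleton, inv_mul_cancel₀ hu,
    Submodule.one_eq_span]

/-- Colon modules are unchanged when an invertible factor is moved across. -/
theorem colon_mul_of_mul_eq_one {S T : Submodule R K} (h : S * T = 1) (A B : Submodule R K) :
    A / (T * B) = S * (A / B) := by
  apply le_antisymm
  · calc A / (T * B) = S * (T * (A / (T * B))) := by rw [← mul_assoc, h, one_mul]
      _ ≤ S * (A / B) := by
        refine mul_le_mul_right (Submodule.le_div_iff_mul_le.2 ?_) _
        calc T * (A / (T * B)) * B = A / (T * B) * (T * B) := by ring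
          _ ≤ A := colon_mul_le _ _
  · refine Submodule.le_div_iff_mul_le.2 ?_
    calc S * (A / B) * (T * B) = (S * T) * (A / B * B) := by ring
      _ ≤ A := by rw [h, one_mul]; exact colon_mul_le _ _

theorem mul_colon_mul_of_mul_eq_one {S T : Submodule R K} (h : S * T = 1)
    (A B : Submodule R K) : (T * A) / (T * B) = A / B := by
  refine eq_of_forall_le_iff fun X => ?_
  rw [Submodule.le_div_iff_mul_le, Submodule.le_div_iff_mul_le, mul_left_comm]
  refine ⟨fun hX => ?_, fun hX => mul_le_mul_right hX T⟩
  simpa only [← mul_assoc, h, one_mul] using mul_le_mul_right hX S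

theorem isReflexive_mul_iff {S T : Submodule R K} (h : S * T = 1) (A : Submodule R K) :
    IsReflexive (T * A) ↔ IsReflexive A := by
  have h' : T * S = 1 := (mul_comm _ _).trans h
  rw [IsReflexive, IsReflexive, dual, dual, dual, dual, colon_mul_of_mul_eq_one h,
    colon_mul_of_mul_eq_one h']
  refine ⟨fun e => ?_, fun e => congrArg (T * ·) e⟩
  simpa only [← mul_assoc, h, one_mul] using congrArg (S * ·) e

theorem pow_eq_of_le {M : Submodule R K} {N : ℕ} (hM : ∀ n ≥ N, M ^ (n + 1) = M ^ n)
    {n : ℕ} (hn : N ≤ n) : M ^ n = M ^ N := by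
  induction n, hn using Nat.le_induction with
  | base => rfl
  | succ n hn ih => rw [hM n hn, ih]

/-- If the powers of `M ∋ 1` stabilize, the stable power is its own colon module. -/
theorem pow_colon_pow {M : Submodule R K} (h1 : 1 ≤ M) {N : ℕ}
    (hM : ∀ n ≥ N, M ^ (n + 1) = M ^ n) : M ^ N / M ^ N = M ^ N := by
  apply le_antisymm
  · calc M ^ N / M ^ N = M ^ N / M ^ N * 1 := (mul_one _).symm
      _ ≤ M ^ N / M ^ N * M ^ N := mul_le_mul_right (one_le_pow_of_one_le' h1 N) _
      _ ≤ M ^ N := colon_mul_le _ _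
  · rw [Submodule.le_div_iff_mul_le, ← pow_add, pow_eq_of_le hM (Nat.le_add_left N N)]

theorem toK_mul (I J : Ideal R) : toK K (I * J) = toK K I * toK K J :=
  IsLocalization.coeSubmodule_mul K I J

theorem toK_pow (I : Ideal R) (n : ℕ) : toK K (I ^ n) = toK K I ^ n := by
  induction n with
  | zero => simp [toK, Ideal.one_eq_top, IsLocalization.coeSubmodule_top]
  | succ n ih => rw [pow_succ, pow_succ, toK_mul, ih]

theorem toK_span_singleton (x : R) :
    toK K (Ideal.span {x}) = Submodule.span R {algebraMap R K x} := by
  rw [toK, IsLocalization.coeSubmodule_span, Set.image_singleton]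

theorem toK_injective [IsFractionRing R K] : Function.Injective (toK K : Ideal R → Submodule R K) :=
  IsFractionRing.coeSubmodule_injective R K

theorem toK_mono {I J : Ideal R} (h : I ≤ J) : toK K I ≤ toK K J :=
  IsLocalization.coeSubmodule_mono K h

theorem toK_le_one (I : Ideal R) : toK K I ≤ 1 := by
  have h := toK_mono (K := K) (le_top : I ≤ ⊤)
  rwa [toK, toK, IsLocalization.coeSubmodule_top] at h

/-- Submodules of `K` contained in `R` come from ideals of `R`. -/
theorem exists_toK_eq {A : Submodule R K} (h : A ≤ 1) : ∃ J : Ideal R, toK K J = A := by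
  refine ⟨A.comap (Algebra.linearMap R K), ?_⟩
  rw [toK, IsLocalization.coeSubmodule, Submodule.map_comap_eq, ← Submodule.one_eq_range]
  exact inf_eq_right.2 h

/-- A submodule of `R` that is not `R` lies in the maximal ideal. -/
theorem le_toK_maximalIdeal [IsLocalRing R] {A : Submodule R K} (h : A ≤ 1) (h' : A ≠ 1) :
    A ≤ toK K (maximalIdeal R) := by
  obtain ⟨J, rfl⟩ := exists_toK_eq h
  refine toK_mono (IsLocalRing.le_maximalIdeal ?_)
  rintro rfl
  exact h' (IsLocalization.coeSubmodule_top K)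

end Colon

section ReductionExponent

variable {R : Type*} [CommRing R]

theorem IsMinimalReduction.pow_succ_eq {I : Ideal R} {x : R} (hx : IsMinimalReduction I x)
    {n : ℕ} (hn : reductionExponent I x ≤ n) : I ^ (n + 1) = Ideal.span {x} * I ^ n :=
  Nat.sInf_mem (s := {m : ℕ | ∀ n ≥ m, I ^ (n + 1) = Ideal.span {x} * I ^ n}) hx.2 n hn

/-- Exponent `0` would read `I = (x)`. Positivity keeps `Iⁿ` inside `m` for every `n ≥ ν`. -/
theorem IsMinimalReduction.reductionExponent_pos {I : Ideal R} {x : R}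
    (hx : IsMinimalReduction I x) (hI : ¬ Submodule.IsPrincipal I) :
    0 < reductionExponent I x := by
  refine Nat.pos_of_ne_zero fun h => hI ?_
  have := hx.pow_succ_eq h.le
  rw [zero_add, pow_one, pow_zero, mul_one] at this
  exact ⟨⟨x, this⟩⟩

end ReductionExponent

/-! ### The blowing-up as a stable power of `x⁻¹I`. -/

section Blowup

variable {R K : Type*} [CommRing R] [IsDomain R] [Field K] [Algebra R K] [IsFractionRing R K]

theorem mem_blowup {I : Ideal R} {z : K} :
    z ∈ blowup K I ↔ ∃ n : ℕ, z ∈ toK K I ^ n / toK K I ^ n :=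
  Set.mem_iUnion

theorem IsMinimalReduction.ne_zero {I : Ideal R} {x : R} (hx : IsMinimalReduction I x)
    (hI : I ≠ ⊥) : x ≠ 0 := by
  rintro rfl
  obtain ⟨N, hN⟩ := hx.2
  have h := hN N le_rfl
  rw [Ideal.span_singleton_eq_bot.2 rfl, Ideal.bot_mul] at h
  exact hI (eq_bot_iff.2 fun a ha => by
    have := h ▸ Ideal.pow_mem_pow ha (N + 1)
    exact pow_eq_zero_iff (Nat.succ_ne_zero N) |>.1 (Ideal.mem_bot.1 this))

/-- `x⁻ⁿ Iⁿ`, for `n` at least the reduction exponent, is the blowing-up. -/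
theorem IsMinimalReduction.blowup_eq {I : Ideal R} {x : R} (hx : IsMinimalReduction I x)
    (hI : I ≠ ⊥) :
    blowup K I =
      (Submodule.span R {(algebraMap R K x)⁻¹} * toK K I) ^ reductionExponent I x ∧
    1 ≤ Submodule.span R {(algebraMap R K x)⁻¹} * toK K I ∧
    ∀ n ≥ reductionExponent I x,
      (Submodule.span R {(algebraMap R K x)⁻¹} * toK K I) ^ (n + 1) =
        (Submodule.span R {(algebraMap R K x)⁻¹} * toK K I) ^ n := by
  have hu : algebraMap R K x ≠ 0 := by
    simpa using hx.ne_zero hI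
  set u := algebraMap R K x with hudef
  set S := Submodule.span R {u⁻¹} with hS
  set T := Submodule.span R {u} with hT
  have hST : S * T = 1 := span_inv_mul_span hu
  set ν := reductionExponent I x with hν
  have h1 : 1 ≤ S * toK K I := by
    rw [← hST]
    refine mul_le_mul_right ?_ S
    rw [hT, hudef, ← toK_span_singleton]
    exact toK_mono ((Ideal.span_singleton_le_iff_mem I).2 hx.1)
  have hM : ∀ n ≥ ν, (S * toK K I) ^ (n + 1) = (S * toK K I) ^ n := fun n hn => by
    have h := congrArg (toK K) (hx.pow_succ_eq hn)
    rw [toK_mul, toK_pow, toK_pow, toK_span_singleton] at h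
    rw [mul_pow, h, mul_pow, pow_succ]
    calc S ^ n * S * (T * toK K I ^ n) = (S * T) * (S ^ n * toK K I ^ n) := by ring
      _ = _ := by rw [hST, one_mul]
  have hcolon : ∀ n, toK K I ^ n / toK K I ^ n = (S * toK K I) ^ n / (S * toK K I) ^ n := by
    intro n
    have hn : T ^ n * S ^ n = 1 := by rw [← mul_pow, mul_comm T, hST, one_pow]
    rw [mul_pow]
    exact (mul_colon_mul_of_mul_eq_one hn _ _).symm
  refine ⟨le_antisymm (fun z hz => ?_) fun z hz => ?_, h1, hM⟩
  · obtain ⟨n, hn⟩ := mem_blowup.1 hz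
    -- The colon modules increase, so the index can be pushed into the stable range.
    have := pow_div_pow_mono (toK K I) (le_max_left n ν) hn
    simp only [hcolon] at this
    rwa [pow_eq_of_le hM (le_max_right n ν), pow_colon_pow h1 hM] at this
  · refine mem_blowup.2 ⟨ν, ?_⟩
    rwa [hcolon, pow_colon_pow h1 hM]

theorem IsMinimalReduction.pow_eq_mul_blowup {I : Ideal R} {x : R}
    (hx : IsMinimalReduction I x) (hI : I ≠ ⊥) {n : ℕ} (hn : reductionExponent I x ≤ n) :
    toK K I ^ n = Submodule.span R {algebraMap R K x} ^ n * blowup K I := by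
  have hu : algebraMap R K x ≠ 0 := by simpa using hx.ne_zero hI
  obtain ⟨h, -, hM⟩ := hx.blowup_eq (K := K) hI
  rw [h, ← pow_eq_of_le hM hn, mul_pow, ← mul_assoc, ← mul_pow,
    mul_comm (Submodule.span R {algebraMap R K x}), span_inv_mul_span hu, one_pow, one_mul]

theorem one_le_blowup (I : Ideal R) : 1 ≤ blowup K I := fun z hz =>
  mem_blowup.2 ⟨0, by rwa [pow_zero, colon_one]⟩

theorem IsMinimalReduction.blowup_mul_blowup {I : Ideal R} {x : R}
    (hx : IsMinimalReduction I x) (hI : I ≠ ⊥) : blowup K I * blowup K I = blowup K I := by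
  obtain ⟨h, -, hM⟩ := hx.blowup_eq (K := K) hI
  rw [h, ← pow_add, pow_eq_of_le hM (Nat.le_add_left _ _)]

theorem IsMinimalReduction.isFractional_blowup {I : Ideal R} {x : R}
    (hx : IsMinimalReduction I x) (hI : I ≠ ⊥) : IsFractional R⁰ (blowup K I) := by
  set ν := reductionExponent I x with hν
  -- `x ^ ν` is a common denominator because `x^ν Λ = I^ν ⊆ R`.
  refine ⟨x ^ ν, pow_mem (mem_nonZeroDivisors_of_ne_zero (hx.ne_zero hI)) _, fun b hb => ?_⟩
  have hmem : algebraMap R K x ^ ν * b ∈ toK K I ^ ν := by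
    rw [hx.pow_eq_mul_blowup hI hν.ge]
    exact Submodule.mul_mem_mul
      (Submodule.pow_mem_pow _ (Submodule.mem_span_singleton_self _) _) hb
  rw [← toK_pow] at hmem
  obtain ⟨r, hr⟩ := Submodule.mem_one.1 (toK_le_one _ hmem)
  exact ⟨r, by rw [hr, Algebra.smul_def, map_pow]⟩

/-- The blowing-up along a non-principal ideal differs from `R`. -/
theorem IsMinimalReduction.blowup_ne_one {I : Ideal R} {x : R}
    (hx : IsMinimalReduction I x) (hI : I ≠ ⊥) (hI' : ¬ Submodule.IsPrincipal I) :
    blowup K I ≠ 1 := by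
  intro h
  have hu : algebraMap R K x ≠ 0 := by simpa using hx.ne_zero hI
  obtain ⟨hΛ, h1, hM⟩ := hx.blowup_eq (K := K) hI
  refine hI' ⟨⟨x, ?_⟩⟩
  apply toK_injective (K := K)
  -- If `Λ = R`, stability `Λ · x⁻¹I = Λ` collapses to `x⁻¹I = R`, that is, `I = (x)`.
  have hone : Submodule.span R {(algebraMap R K x)⁻¹} * toK K I = 1 := by
    have h2 := hM _ le_rfl
    rwa [pow_succ, ← hΛ, h, one_mul] at h2
  have h3 := toK_span_singleton (K := K) x
  rw [Ideal.span] at h3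
  rw [h3, ← mul_one (Submodule.span R {algebraMap R K x}), ← hone, ← mul_assoc,
    mul_comm (Submodule.span R {algebraMap R K x}), span_inv_mul_span hu, one_mul]

end Blowup

/-! ### Existence of minimal reductions. -/

section Existence

variable {R K : Type*} [CommRing R] [IsDomain R] [Field K] [Algebra R K] [IsFractionRing R K]

/-- An element of `I` of least value in the integral closure is a minimal reduction. -/
theorem exists_isMinimalReduction [IsNoetherianRing R] [Module.Finite R (integralClosure R K)]
    [IsDiscreteValuationRing (integralClosure R K)] {I : Ideal R} (hI : I ≠ ⊥) :
    ∃ x : R, IsMinimalReduction I x := by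
  obtain ⟨x, hxI, hx0, hdiv⟩ : ∃ x ∈ I, x ≠ 0 ∧ ∀ y ∈ I,
      algebraMap R (integralClosure R K) x ∣ algebraMap R (integralClosure R K) y := by
    obtain ⟨y, hyI, hy0⟩ := Submodule.exists_mem_ne_zero_of_ne_bot hI
    have hinj : Function.Injective (algebraMap R (integralClosure R K)) :=
      FaithfulSMul.algebraMap_injective _ _
    let v : R → ℕ∞ := fun r =>
      IsDiscreteValuationRing.addVal (integralClosure R K) (algebraMap R _ r)
    obtain ⟨x, hxI, hmin⟩ : ∃ x ∈ (I : Set R), ∀ z ∈ (I : Set R), v x ≤ v z := by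
      obtain ⟨x, hx, hmin⟩ := exists_minimalFor_of_wellFoundedLT (· ∈ (I : Set R)) v ⟨y, hyI⟩
      exact ⟨x, hx, fun z hz => (le_total (v x) (v z)).elim id (hmin hz)⟩
    have hd : ∀ z ∈ I, algebraMap R (integralClosure R K) x ∣ algebraMap R _ z := fun z hz =>
      IsDiscreteValuationRing.addVal_le_iff_dvd.1 (hmin z hz)
    refine ⟨x, hxI, ?_, hd⟩
    rintro rfl
    have := hd y hyI
    rw [map_zero, zero_dvd_iff] at this
    exact hy0 (hinj (this.trans (map_zero _).symm))
  have hu : algebraMap R K x ≠ 0 := by simpa using hx0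
  set u := algebraMap R K x with hudef
  set S := Submodule.span R {u⁻¹} with hS
  set T := Submodule.span R {u} with hT
  have hST : S * T = 1 := span_inv_mul_span hu
  set V := Subalgebra.toSubmodule (integralClosure R K) with hV
  set M := S * toK K I with hMdef
  have h1 : 1 ≤ M := by
    rw [← hST]
    refine mul_le_mul_right ?_ S
    rw [hT, hudef, ← toK_span_singleton]
    exact toK_mono ((Ideal.span_singleton_le_iff_mem I).2 hxI)
  have hMV : M ≤ V := by
    refine Submodule.mul_le.2 fun s hs t ht => ?_
    obtain ⟨r, rfl⟩ := Submodule.mem_span_singleton.1 hs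
    obtain ⟨y, hy, rfl⟩ := (IsLocalization.mem_coeSubmodule K I).1 ht
    obtain ⟨c, hc⟩ := hdiv y hy
    have hc' : algebraMap R K y = u * c := congrArg Subtype.val hc
    rw [hc', smul_mul_assoc, inv_mul_cancel_left₀ hu]
    exact V.smul_mem r c.2
  have hpow : ∀ n, M ^ n ≤ V := fun n => by
    induction n with
    | zero => rw [pow_zero, hV]; exact Submodule.one_le.2 (one_mem (integralClosure R K))
    | succ n ih =>
      rw [pow_succ]
      exact Submodule.mul_le.2 fun a ha b hb => mul_mem (S := Subalgebra R K) (ih ha) (hMV hb)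
  -- The powers of `M` form an ascending chain in the Noetherian `R`-module `V`, hence stabilize.
  have hmono : Monotone fun n : ℕ => M ^ n := pow_right_monotone h1
  have : IsNoetherian R V := isNoetherian_of_isNoetherianRing_of_finite R (integralClosure R K)
  let f : ℕ →o Submodule R V :=
    ⟨fun n => (M ^ n).comap V.subtype, fun a b hab => Submodule.comap_mono (hmono hab)⟩
  obtain ⟨N, hN⟩ := monotone_stabilizes_iff_noetherian.2 ‹IsNoetherian R V› f
  have hf : ∀ n, (f n).map V.subtype = M ^ n := fun n => by
    change ((M ^ n).comap V.subtype).map V.subtype = M ^ n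
    rw [Submodule.map_comap_subtype]
    exact inf_eq_right.2 (hpow n)
  refine ⟨x, hxI, N, fun n hn => toK_injective (K := K) ?_⟩
  have hMn : M ^ (n + 1) = M ^ n := by
    rw [← hf, ← hf, ← hN n hn, ← hN (n + 1) (by omega)]
  rw [toK_mul, toK_pow, toK_pow, toK_span_singleton]
  have hTM : T * M = toK K I := by rw [hMdef, ← mul_assoc, mul_comm T, hST, one_mul]
  have hpowT : ∀ k, toK K I ^ k = T ^ k * M ^ k := fun k => by rw [← mul_pow, hTM]
  rw [hpowT, hpowT, hMn, pow_succ', mul_assoc]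

end Existence

/-! ### Canonical duality and reflexive ideals. -/

section Canonical

variable {R K : Type*} [CommRing R] [Field K] [Algebra R K]

theorem IsCanonicalIdeal.colon_self {ω : Submodule R K} (hω : IsCanonicalIdeal ω) :
    ω / ω = 1 := by
  have h := hω.dual_dual 1 one_ne_zero
    ⟨1, one_mem _, fun b hb => by
      obtain ⟨r, hr⟩ := Submodule.mem_one.1 hb
      exact ⟨r, by rw [hr, one_smul]⟩⟩
  rwa [colon_one] at h

theorem IsCanonicalIdeal.colon_mul {ω : Submodule R K} (hω : IsCanonicalIdeal ω)
    (J : Submodule R K) : ω / (ω * J) = 1 / J := by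
  rw [← colon_colon, hω.colon_self]

/-- A non-principal ideal of a local domain is not invertible. -/
theorem dual_mul_le_toK_maximalIdeal [IsFractionRing R K] [IsLocalRing R] {I : Ideal R}
    (hI' : ¬ Submodule.IsPrincipal I) :
    dual (toK K I) * toK K I ≤ toK K (maximalIdeal R) := by
  refine Submodule.mul_le.2 fun a ha b hb => ?_
  have hint : ∀ y ∈ I, ∃ s : R, algebraMap R K s = a * algebraMap R K y := fun y hy =>
    Submodule.mem_one.1 (Submodule.mem_div_iff_forall_mul_mem.1 ha _
      ((IsLocalization.mem_coeSubmodule K I).2 ⟨y, hy, rfl⟩))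
  obtain ⟨c, hc, rfl⟩ := (IsLocalization.mem_coeSubmodule K I).1 hb
  obtain ⟨r, hr⟩ := hint c hc
  refine (IsLocalization.mem_coeSubmodule K _).2 ⟨r, ?_, hr⟩
  -- If `r = ac` is a unit, then `c` generates `I`: for `y ∈ I`, `ry = c(ay)` with `ay ∈ R`.
  refine (IsLocalRing.mem_maximalIdeal r).2 fun hunit => hI' ⟨⟨c, ?_⟩⟩
  refine le_antisymm (fun y hy => ?_) ((Ideal.span_singleton_le_iff_mem I).2 hc)
  obtain ⟨s, hs⟩ := hint y hy
  refine Ideal.mem_span_singleton.2 ((hunit.dvd_mul_left).1 ⟨s, ?_⟩)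
  apply IsFractionRing.injective R K
  rw [map_mul, map_mul, hr, hs]
  ring

/-- Over an almost Gorenstein ring, a non-principal reflexive ideal absorbs `ω`. -/
theorem IsAlmostGorenstein.mul_eq_of_isReflexive [IsFractionRing R K] [IsLocalRing R]
    {ω : Submodule R K} (hR : IsAlmostGorenstein ω) (h1 : 1 ≤ ω) {I : Ideal R} (hI' : ¬ Submodule.IsPrincipal I)
    (hrefl : IsReflexive (toK K I)) : ω * toK K I = toK K I := by
  have hm : dual (toK K I) * toK K I ≤ toK K (maximalIdeal R) :=
    dual_mul_le_toK_maximalIdeal hI'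
  apply le_antisymm
  · conv_rhs => rw [hrefl]
    refine Submodule.le_div_iff_mul_le.2 ?_
    calc ω * toK K I * dual (toK K I) = (dual (toK K I) * toK K I) * ω := by ring
      _ ≤ toK K (maximalIdeal R) * ω := mul_le_mul_left hm _
      _ = toK K (maximalIdeal R) := hR.symm
      _ ≤ 1 := toK_le_one _
  · calc toK K I = 1 * toK K I := (one_mul _).symm
      _ ≤ ω * toK K I := mul_le_mul_left h1 _

end Canonical

end CurveSing

/-! ### The equivalences and the reflexive case. -/

open CurveSing in
theorem theorem5p10 {R K : Type*} [CommRing R] [IsDomain R] [IsLocalRing R]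
    [Field K] [Algebra R K] [IsFractionRing R K] [IsCurveBranch R K]
    (ω : Submodule R K) (hω : IsNormalizedCanonicalIdeal ω) (hR : IsAlmostGorenstein ω)
    (I : Ideal R) (hI : I.radical = IsLocalRing.maximalIdeal R)
    (hI' : ¬ Submodule.IsPrincipal I) :
    -- minimal reductions of `I` exist, and for the reduction exponent given by any of them
    -- the conditions (A), (B), (C) are equivalent
    (∃ x : R, IsMinimalReduction I x) ∧
    (∀ x : R, IsMinimalReduction I x →
      List.TFAE [
        -- (A)
        ω ≤ blowup K I,
        ω * blowup K I = blowup K I,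
        ω / blowup K I = 1 / blowup K I,
        ∀ n ≥ reductionExponent I x, toK K I ^ n = canonicalClosure ω (toK K I ^ n),
        ∀ n ≥ reductionExponent I x, ω * toK K I ^ n = toK K I ^ n,
        ∃ n > 0, ω * toK K I ^ n = toK K I ^ n,
        -- (B)
        IsReflexive (blowup K I),
        ω / blowup K I = ω * (1 / blowup K I),
        -- (C)
        1 / toK K (IsLocalRing.maximalIdeal R) ≤ blowup K I,
        IsReflexive (toK K I ^ reductionExponent I x),
        ∀ n ≥ reductionExponent I x, IsReflexive (toK K I ^ n),
        ∃ n ≥ reductionExponent I x, IsReflexive (toK K I ^ n)]) ∧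
    -- if `I` is reflexive, then (A), (B), (C) hold; in particular `Λ` is reflexive
    (IsReflexive (toK K I) →
      ω ≤ blowup K I ∧ IsReflexive (blowup K I) ∧
        1 / toK K (IsLocalRing.maximalIdeal R) ≤ blowup K I) := by

  have := IsCurveBranch.noetherian (R := R) (K := K)
  have := IsCurveBranch.finite_integralClosure (R := R) (K := K)
  have := IsCurveBranch.dvr_integralClosure (R := R) (K := K)
  have hI0 : I ≠ ⊥ := fun h => hI' (h ▸ inferInstance)
  have hIm : I ≤ maximalIdeal R := hI ▸ Ideal.le_radical
  have h1ω := hω.one_le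
  have h1Λ : 1 ≤ blowup K I := one_le_blowup I
  have hle : ∀ A : Submodule R K, A ≤ ω * A := fun A => by
    simpa only [one_mul] using mul_le_mul_left h1ω A
  obtain ⟨x₀, hx₀⟩ := exists_isMinimalReduction (K := K) hI0
  have htfae : ∀ x : R, IsMinimalReduction I x → List.TFAE [
        ω ≤ blowup K I,
        ω * blowup K I = blowup K I,
        ω / blowup K I = 1 / blowup K I,
        ∀ n ≥ reductionExponent I x, toK K I ^ n = canonicalClosure ω (toK K I ^ n),
        ∀ n ≥ reductionExponent I x, ω * toK K I ^ n = toK K I ^ n,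
        ∃ n > 0, ω * toK K I ^ n = toK K I ^ n,
        IsReflexive (blowup K I),
        ω / blowup K I = ω * (1 / blowup K I),
        1 / toK K (IsLocalRing.maximalIdeal R) ≤ blowup K I,
        IsReflexive (toK K I ^ reductionExponent I x),
        ∀ n ≥ reductionExponent I x, IsReflexive (toK K I ^ n),
        ∃ n ≥ reductionExponent I x, IsReflexive (toK K I ^ n)] := by
    intro x hx
    have hu : algebraMap R K x ≠ 0 := by simpa using hx.ne_zero hI0
    have hν := hx.reductionExponent_pos hI'
    have hΛΛ := hx.blowup_mul_blowup (K := K) hI0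
    have hΛ1 := hx.blowup_ne_one (K := K) hI0 hI'
    have hΛpow := fun n (hn : reductionExponent I x ≤ n) =>
      hx.pow_eq_mul_blowup (K := K) hI0 hn
    have hΛ0 : blowup K I ≠ ⊥ := fun h => one_ne_zero (le_bot_iff.1 (h ▸ h1Λ))
    have hdd := hω.dual_dual _ hΛ0 (hx.isFractional_blowup hI0)
    have hinv : ∀ n : ℕ, Submodule.span R {(algebraMap R K x)⁻¹} ^ n *
        Submodule.span R {algebraMap R K x} ^ n = 1 := fun n => by
      rw [← mul_pow, span_inv_mul_span hu, one_pow]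
    have habs : ∀ n ≥ reductionExponent I x,
        (ω * toK K I ^ n = toK K I ^ n ↔ ω * blowup K I = blowup K I) := fun n hn => by
      rw [hΛpow n hn, mul_left_comm]
      refine ⟨fun h => ?_, fun h => congrArg _ h⟩
      simpa only [← mul_assoc, hinv, one_mul] using
        congrArg (Submodule.span R {(algebraMap R K x)⁻¹} ^ n * ·) h
    have hrefl : ∀ n ≥ reductionExponent I x,
        (IsReflexive (toK K I ^ n) ↔ IsReflexive (blowup K I)) := fun n hn => by
      rw [hΛpow n hn, isReflexive_mul_iff (hinv n)]
    tfae_have 1 → 2 := fun h =>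
      ((mul_le_mul_left h _).trans hΛΛ.le).antisymm (hle _)
    tfae_have 2 → 1 := fun h => by
      rw [← h]
      simpa only [mul_one] using mul_le_mul_right h1Λ ω
    tfae_have 2 → 3 := fun h => by
      conv_lhs => rw [← h]
      exact hω.colon_mul _
    tfae_have 3 → 2 := fun h => by
      refine le_antisymm ?_ (hle _)
      -- `Λ = ω : (ω : Λ) = ω : (R : Λ) = ω : (ω : ωΛ)`, which contains `ωΛ`.
      conv_rhs => rw [← hdd, h, ← hω.colon_mul]
      exact Submodule.le_div_iff_mul_le.2 ((mul_comm _ _).trans_le (colon_mul_le _ _))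
    tfae_have 4 ↔ 5 := by
      refine forall₂_congr fun n hn => ?_
      have hn0 : n ≠ 0 := (hν.trans_le hn).ne'
      have hm : toK K I ^ n ≤ toK K (maximalIdeal R) := by
        rw [← toK_pow]
        exact toK_mono ((Ideal.pow_le_self hn0).trans hIm)
      -- As `mω = m`, the product `Iⁿω` already lies in `R`, so intersecting with `R` changes
      -- nothing.
      have h1 : toK K I ^ n * ω ≤ 1 :=
        (mul_le_mul_left hm ω).trans (hR.symm.le.trans (toK_le_one _))
      rw [canonicalClosure, inf_eq_left.2 h1, mul_comm, eq_comm]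
    tfae_have 2 → 5 := fun h n hn => (habs n hn).2 h
    tfae_have 5 → 6 := fun h => ⟨_, hν, h _ le_rfl⟩
    tfae_have 6 → 2 := by
      rintro ⟨n, -, h⟩
      -- The given `n` may be below `ν`; multiplying by `I^ν` moves it into the stable range.
      refine (habs (n + reductionExponent I x) (Nat.le_add_left _ _)).1 ?_
      rw [pow_add, ← mul_assoc, h]
    tfae_have 3 → 7 := fun h => by
      refine (le_dual_dual _).antisymm ?_
      -- `Λ** = R : (R : Λ) ⊆ ω : (R : Λ) = ω : (ω : Λ) = Λ`.
      conv_rhs => rw [← hdd, h]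
      exact colon_mono h1ω _
    tfae_have 7 → 9 := fun h => by
      rw [h]
      refine colon_antitone 1 (le_toK_maximalIdeal ?_ fun h' => hΛ1 ?_)
      · exact (colon_antitone 1 h1Λ).trans_eq (colon_one 1)
      · rw [h, h', dual, colon_one]
    tfae_have 9 → 1 := fun h => by
      refine le_trans (Submodule.le_div_iff_mul_le.2 ?_) h
      rw [mul_comm, ← hR]
      exact toK_le_one _
    tfae_have 1 → 8 := fun h => by
      rw [tfae_2_to_3 (tfae_1_to_2 h)]
      -- `R : Λ` is a `Λ`-module, so it absorbs `ω ⊆ Λ`.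
      refine (hle _).antisymm (Submodule.le_div_iff_mul_le.2 ?_)
      calc ω * (1 / blowup K I) * blowup K I
          ≤ blowup K I * (1 / blowup K I) * blowup K I := by gcongr
        _ = 1 / blowup K I * (blowup K I * blowup K I) := by ring
        _ ≤ 1 := by rw [hΛΛ]; exact colon_mul_le _ _
    tfae_have 8 → 7 := fun h => by
      -- Duality becomes `Λ = ω : ω(R : Λ) = R : (R : Λ)`.
      rw [h, hω.colon_mul] at hdd
      exact hdd.symm
    tfae_have 7 → 11 := fun h n hn => (hrefl n hn).2 h
    tfae_have 11 → 10 := fun h => h _ le_rfl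
    tfae_have 10 → 12 := fun h => ⟨_, le_rfl, h⟩
    tfae_have 12 → 7 := fun ⟨n, hn, h⟩ => (hrefl n hn).1 h
    tfae_finish
  refine ⟨⟨x₀, hx₀⟩, htfae, fun hr => ?_⟩
  have h6 : ∃ n > 0, ω * toK K I ^ n = toK K I ^ n :=
    ⟨1, one_pos, by rw [pow_one, hR.mul_eq_of_isReflexive h1ω hI' hr]⟩
  have T := htfae x₀ hx₀
  exact ⟨(T.out 5 0).1 h6, (T.out 5 6).1 h6, (T.out 5 8).1 h6⟩
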